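/- Let $\|\cdot\|$ denote the operator (spectral) norm of complex matrices. Let $A_0$ be an $n\times n$ complex Hermitian matrix of rank $m$ and set $l=n-m$. Then there are radii $r_A,r_E>0$ and a constant $c>0$ such that the following holds for every $n\times n$ Hermitian matrix $A$ of rank $m$ with $\|A-A_0\|<r_A$ and every $n\times n$ Hermitian matrix $E$ with $\|E\|<r_E$. Let $U=[U_1\ U_2]$ be any unitary matrix of eigenvectors of $A$ such that the $l$ columns of $U_1$ span $\ker A$ and the $m$ columns of $U_2$ span $(\ker A)^\perp$, so that $$A=U\begin{pmatrix}0&0\\0&\Lambda_\tau\end{pmatrix}U^*,$$ where $\Lambda_\tau$ is the diagonal matrix of the nonzero eigenvalues $\tau_1,\dots,\tau_m$ of $A$, and write $$\hat E=U^*EU=\begin{pmatrix}\hat E_{11}&C\\ C^*&D\end{pmatrix}.$$ Then $\Lambda_\tau+D$ is invertible. With the Schur complement $$B=\hat E_{11}-C(\Lambda_\tau+D)^{-1}C^*$$ and its eigenvalues $\beta_1\ge\dots\ge\beta_l$ (with multiplicity), the eigenvalues $\xi_1,\dots,\xi_n$ of $A+E$ (with multiplicity) can be ordered so that $$|\xi_j-\beta_j|\le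 c\,\|B\|\,\|C\|^2,\qquad 1\le j\le l.$$ -/

import Mathlib

open scoped Matrix Matrix.Norms.L2Operator

/-- The block matrix with diagonal blocks `0` (of size `l`) and `Λ_τ` (of size `m`). -/
noncomputable def kernelModel (l : ℕ) {m : ℕ} (τ : Fin m → ℝ) :
    Matrix (Fin l ⊕ Fin m) (Fin l ⊕ Fin m) ℂ :=
  Matrix.fromBlocks 0 0 0 (Matrix.diagonal fun i => (τ i : ℂ))

/-- `U = [U₁ U₂]` is a unitary matrix of eigenvectors of `A`, the columns of `U₁` (indexed by
`Fin l`) spanning the kernel of `A` and those of `U₂` (indexed by `Fin m`) spanning its orthogonal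
complement, with corresponding nonzero eigenvalues `τ`. -/
structure IsKernelSplitting {n l m : ℕ} (A : Matrix (Fin n) (Fin n) ℂ)
    (U : Matrix (Fin n) (Fin l ⊕ Fin m) ℂ) (τ : Fin m → ℝ) : Prop where
  conjTranspose_mul_self : Uᴴ * U = 1
  mul_conjTranspose_self : U * Uᴴ = 1
  ne_zero : ∀ i, τ i ≠ 0
  spectral : A = U * kernelModel l τ * Uᴴ

namespace KernelSplitting

variable {n l m : ℕ}

/-- The matrix `Ê = U* E U` of the perturbation in the basis `U`. -/
def hat (U : Matrix (Fin n) (Fin l ⊕ Fin m) ℂ) (E : Matrix (Fin n) (Fin n) ℂ) :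
    Matrix (Fin l ⊕ Fin m) (Fin l ⊕ Fin m) ℂ :=
  Uᴴ * E * U

/-- The off-diagonal block `C = Ê₁₂`. -/
def blockC (U : Matrix (Fin n) (Fin l ⊕ Fin m) ℂ) (E : Matrix (Fin n) (Fin n) ℂ) :
    Matrix (Fin l) (Fin m) ℂ :=
  (hat U E).toBlocks₁₂

/-- The diagonal block `D = Ê₂₂`. -/
def blockD (U : Matrix (Fin n) (Fin l ⊕ Fin m) ℂ) (E : Matrix (Fin n) (Fin n) ℂ) :
    Matrix (Fin m) (Fin m) ℂ :=
  (hat U E).toBlocks₂₂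

/-- The block `Λ_τ + D` of `U* (A + E) U`. -/
noncomputable def pivot (U : Matrix (Fin n) (Fin l ⊕ Fin m) ℂ) (τ : Fin m → ℝ)
    (E : Matrix (Fin n) (Fin n) ℂ) : Matrix (Fin m) (Fin m) ℂ :=
  Matrix.diagonal (fun i => (τ i : ℂ)) + blockD U E

/-- The Schur complement `B = Ê₁₁ - C (Λ_τ + D)⁻¹ C*`. -/
noncomputable def schurB (U : Matrix (Fin n) (Fin l ⊕ Fin m) ℂ) (τ : Fin m → ℝ)
    (E : Matrix (Fin n) (Fin n) ℂ) : Matrix (Fin l) (Fin l) ℂ :=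
  (hat U E).toBlocks₁₁ - blockC U E * (pivot U τ E)⁻¹ * (blockC U E)ᴴ

theorem hat_isHermitian (U : Matrix (Fin n) (Fin l ⊕ Fin m) ℂ) {E : Matrix (Fin n) (Fin n) ℂ}
    (hE : E.IsHermitian) : (hat U E).IsHermitian :=
  Matrix.isHermitian_conjTranspose_mul_mul U hE

theorem schurB_isHermitian (U : Matrix (Fin n) (Fin l ⊕ Fin m) ℂ) (τ : Fin m → ℝ)
    {E : Matrix (Fin n) (Fin n) ℂ} (hE : E.IsHermitian) : (schurB U τ E).IsHermitian := by
  have hH := hat_isHermitian U hE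
  have h11 : (hat U E).toBlocks₁₁.IsHermitian := hH.submatrix Sum.inl
  have h22 : (blockD U E).IsHermitian := hH.submatrix Sum.inr
  have hd : (Matrix.diagonal (fun i => (τ i : ℂ))).IsHermitian :=
    Matrix.isHermitian_diagonal_of_self_adjoint _ (by
      ext i; simp)
  exact h11.sub (Matrix.isHermitian_mul_mul_conjTranspose _ (hd.add h22).inv)

/-- The eigenvalues `β₁ ≥ … ≥ β_l` of `B`, with multiplicity, in non-increasing order. -/
noncomputable def beta (U : Matrix (Fin n) (Fin l ⊕ Fin m) ℂ) (τ : Fin m → ℝ)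
    {E : Matrix (Fin n) (Fin n) ℂ} (hE : E.IsHermitian) : Fin l → ℝ :=
  fun j => (schurB_isHermitian U τ hE).eigenvalues₀ (Fin.cast (Fintype.card_fin l).symm j)

end KernelSplitting

/-! Block elimination turns the form of `A + E` into a direct sum. With `P = Λ_τ + D` and `R = P⁻¹
C*`, the substitution `(x, w) ↦ U₁ x + U₂ (w - R x)` carries it to `⟨x, B x⟩ + ⟨w, P w⟩`, while the
squared norm becomes `‖x‖² + ‖w - R x‖²` (`quadForm_add_shear`). The eigenvalues would be those of
`B` and `P` but for the shear in the norm.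

Courant–Fischer measures this defect (`exists_equiv_eigenvalues_sub_le`). A test space for `β_j` is
joined to the positive or to the nonpositive eigenspaces of `P`. The shear enters only multiplied by
`β_j`, hence the factor `‖B‖` beside `‖R‖² = O(‖C‖²)`; the cross terms are absorbed because the
spectrum of `P` lies at distance at least `2‖B‖` from `0`.

Uniformity in `A` comes from a lower bound of `A₀` on a complement of its kernel: it survives small
perturbations and bounds every `|τ_i|` from below (`le_abs`). -/

namespace Matrix

/-! ### Quadratic forms in an eigenbasis -/

section QuadraticForm

variable {ι : Type*} [Fintype ι] [DecidableEq ι]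

/-- The quadratic form `v ↦ ⟪v, H v⟫` (real part) of a square complex matrix. -/
noncomputable def quadForm (H : Matrix ι ι ℂ) (v : EuclideanSpace ℂ ι) : ℝ :=
  (inner ℂ v (toEuclideanLin H v)).re

namespace IsHermitian

variable {H : Matrix ι ι ℂ}

theorem toEuclideanLin_eigenvectorBasis (hH : H.IsHermitian) (i : ι) :
    toEuclideanLin H (hH.eigenvectorBasis i) =
      (hH.eigenvalues i : ℂ) • hH.eigenvectorBasis i := by
  ext j
  have := congrFun (hH.mulVec_eigenvectorBasis i) j
  simpa [toLpLin_apply] using this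

theorem quadForm_eq_sum (hH : H.IsHermitian) (v : EuclideanSpace ℂ ι) :
    quadForm H v = ∑ i, hH.eigenvalues i * ‖inner ℂ (hH.eigenvectorBasis i) v‖ ^ 2 := by
  have hs := isSymmetric_toEuclideanLin_iff.mpr hH
  rw [quadForm, ← hH.eigenvectorBasis.sum_inner_mul_inner, Complex.re_sum]
  refine Finset.sum_congr rfl fun i _ => ?_
  rw [← hs, toEuclideanLin_eigenvectorBasis, inner_smul_left, Complex.conj_ofReal,
    mul_left_comm, Complex.re_ofReal_mul]
  have h := inner_mul_symm_re_eq_norm (𝕜 := ℂ) v (hH.eigenvectorBasis i)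
  rw [norm_mul, norm_inner_symm, ← sq] at h
  exact congrArg _ h

/-- The span of the eigenvectors with index in `S`: on it the quadratic form is controlled by the
eigenvalues with index in `S`. -/
theorem exists_submodule_quadForm (hH : H.IsHermitian) (S : Finset ι) :
    ∃ V : Submodule ℂ (EuclideanSpace ℂ ι), Module.finrank ℂ V = S.card ∧
      ∀ v ∈ V, ∀ t : ℝ,
        ((∀ i ∈ S, t ≤ hH.eigenvalues i) → t * ‖v‖ ^ 2 ≤ quadForm H v) ∧
        ((∀ i ∈ S, hH.eigenvalues i ≤ t) → quadForm H v ≤ t * ‖v‖ ^ 2) := by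
  set b := hH.eigenvectorBasis with hb
  refine ⟨Submodule.span ℂ (Set.range fun i : S => b i), ?_, fun v hv t => ?_⟩
  · rw [finrank_span_eq_card, Fintype.card_coe]
    exact b.orthonormal.linearIndependent.comp _ Subtype.val_injective
  · have hzero : ∀ i ∉ S, inner ℂ (b i) v = 0 := by
      intro i hi
      induction hv using Submodule.span_induction with
      | mem x hx =>
        obtain ⟨j, rfl⟩ := hx
        exact b.orthonormal.2 fun h => hi (h ▸ j.2)
      | zero => simp
      | add x y _ _ hx hy => rw [inner_add_right, hx, hy, add_zero]
      | smul a x _ hx => rw [inner_smul_right, hx, mul_zero]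
    rw [hH.quadForm_eq_sum, ← b.sum_sq_norm_inner_right v, Finset.mul_sum]
    constructor <;> intro h <;> refine Finset.sum_le_sum fun i _ => ?_ <;>
      by_cases hi : i ∈ S
    · exact mul_le_mul_of_nonneg_right (h i hi) (sq_nonneg _)
    · simp [← hb, hzero i hi]
    · exact mul_le_mul_of_nonneg_right (h i hi) (sq_nonneg _)
    · simp [← hb, hzero i hi]

end IsHermitian

end QuadraticForm

end Matrix

/-! ### Dimension counts and Courant–Fischer bounds -/

theorem Submodule.exists_ne_zero_mem_of_finrank_lt {K V : Type*} [DivisionRing K] [AddCommGroup V]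
    [Module K V] [FiniteDimensional K V] {P Q : Submodule K V}
    (h : Module.finrank K V < Module.finrank K P + Module.finrank K Q) :
    ∃ v ∈ P, v ∈ Q ∧ v ≠ 0 := by
  by_contra! hc
  refine absurd (Submodule.finrank_add_finrank_le_of_disjoint (s := P) (t := Q) ?_) h.not_ge
  exact Submodule.disjoint_def.2 hc

theorem Submodule.finrank_prod_eq_add {K V W : Type*} [DivisionRing K] [AddCommGroup V]
    [Module K V] [FiniteDimensional K V] [AddCommGroup W] [Module K W] [FiniteDimensional K W]
    (P : Submodule K V) (Q : Submodule K W) :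
    Module.finrank K (P.prod Q) = Module.finrank K P + Module.finrank K Q := by
  have h : P.prod Q = LinearMap.range (P.subtype.prodMap Q.subtype) := by
    rw [LinearMap.range_prodMap, Submodule.range_subtype, Submodule.range_subtype]
  rw [h, LinearMap.finrank_range_of_inj, Module.finrank_prod]
  exact P.subtype_injective.prodMap Q.subtype_injective

namespace Matrix.IsHermitian

variable {N : ℕ} {M : Matrix (Fin N) (Fin N) ℂ}

/-- The position of the `k`-th largest eigenvalue in `eigenvalues`. -/
noncomputable def sortIndex (N : ℕ) : Fin N ≃ Fin N :=
  (finCongr (Fintype.card_fin N).symm).trans (Fintype.equivOfCardEq (Fintype.card_fin _))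

theorem eigenvalues_sortIndex_antitone (hM : M.IsHermitian) :
    Antitone fun k => hM.eigenvalues (sortIndex N k) := by
  intro a b hab
  simp only [eigenvalues, sortIndex, Equiv.trans_apply, Equiv.symm_apply_apply]
  exact hM.eigenvalues₀_antitone (by simpa using hab)

theorem eigenvalues_sortIndex (hM : M.IsHermitian) (k : Fin N) :
    hM.eigenvalues (sortIndex N k) = hM.eigenvalues₀ (Fin.cast (Fintype.card_fin N).symm k) := by
  simp [eigenvalues, sortIndex]

/-- Courant–Fischer, lower bound. -/
theorem le_eigenvalues_of_finrank (hM : M.IsHermitian) (k : Fin N) {t : ℝ}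
    (V : Submodule ℂ (EuclideanSpace ℂ (Fin N))) (hV : k + 1 ≤ Module.finrank ℂ V)
    (h : ∀ v ∈ V, t * ‖v‖ ^ 2 ≤ quadForm M v) : t ≤ hM.eigenvalues (sortIndex N k) := by
  -- Indices start at `0`, so the eigenvectors from position `k` on span dimension `N - k`, just
  -- enough to meet `V`.
  obtain ⟨W, hW, hq⟩ := hM.exists_submodule_quadForm
    ((Finset.Ici k).map (sortIndex N).toEmbedding)
  obtain ⟨v, hvV, hvW, hv0⟩ := Submodule.exists_ne_zero_mem_of_finrank_lt (P := V) (Q := W) (by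
    rw [hW, Finset.card_map, Fin.card_Ici, finrank_euclideanSpace, Fintype.card_fin]
    omega)
  have hle := (h v hvV).trans ((hq v hvW (hM.eigenvalues (sortIndex N k))).2 (by
    intro i hi
    obtain ⟨a, ha, rfl⟩ := Finset.mem_map.1 hi
    exact hM.eigenvalues_sortIndex_antitone (Finset.mem_Ici.1 ha)))
  exact le_of_mul_le_mul_right hle (by positivity)

/-- Courant–Fischer, upper bound. -/
theorem eigenvalues_le_of_finrank (hM : M.IsHermitian) (k : Fin N) {t : ℝ}
    (V : Submodule ℂ (EuclideanSpace ℂ (Fin N))) (hV : N ≤ Module.finrank ℂ V + k)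
    (h : ∀ v ∈ V, quadForm M v ≤ t * ‖v‖ ^ 2) : hM.eigenvalues (sortIndex N k) ≤ t := by
  obtain ⟨W, hW, hq⟩ := hM.exists_submodule_quadForm
    ((Finset.Iic k).map (sortIndex N).toEmbedding)
  obtain ⟨v, hvV, hvW, hv0⟩ := Submodule.exists_ne_zero_mem_of_finrank_lt (P := V) (Q := W) (by
    rw [hW, Finset.card_map, Fin.card_Iic, finrank_euclideanSpace, Fintype.card_fin]
    omega)
  have hle := ((hq v hvW (hM.eigenvalues (sortIndex N k))).1 (by
    intro i hi
    obtain ⟨a, ha, rfl⟩ := Finset.mem_map.1 hi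
    exact hM.eigenvalues_sortIndex_antitone (Finset.mem_Iic.1 ha))).trans (h v hvV)
  exact le_of_mul_le_mul_right hle (by positivity)

end Matrix.IsHermitian

/-! ### Eigenvalue comparison under a shear -/

theorem exists_equiv_sum_extending {l m n : ℕ} (hl : l + m = n) (f : Fin l → Fin n)
    (hf : Function.Injective f) : ∃ σ : Fin l ⊕ Fin m ≃ Fin n, ∀ j, σ (Sum.inl j) = f j := by
  classical
  have hcard : Fintype.card (Fin m) = Fintype.card ((Set.range f)ᶜ : Set (Fin n)) := by
    rw [Fintype.card_compl_set, Set.card_range_of_injective hf]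
    simp only [Fintype.card_fin]
    omega
  exact ⟨((Equiv.ofInjective f hf).sumCongr (Fintype.equivOfCardEq hcard)).trans
    (Equiv.Set.sumCompl (Set.range f)), fun j => by simp⟩

theorem sq_norm_sub_le {E : Type*} [SeminormedAddCommGroup E] (x y : E) :
    ‖x - y‖ ^ 2 ≤ 2 * ‖x‖ ^ 2 + 2 * ‖y‖ ^ 2 := by
  have h := norm_sub_le x y
  nlinarith [norm_nonneg (x - y), sq_nonneg (‖x‖ - ‖y‖)]

namespace Matrix.IsHermitian

/-- If the form of `M` splits, along a linear parametrization `Φ` that is isometric up to a shear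
by `R`, into the forms of `B` and `P`, and the spectrum of `P` is twice as far from `0` as the one
of `B` reaches, then the eigenvalues of `B` approximate eigenvalues of `M` to second order in
`R`. -/
theorem exists_equiv_eigenvalues_sub_le {l m n : ℕ} (hl : l + m = n)
    {B : Matrix (Fin l) (Fin l) ℂ} {P : Matrix (Fin m) (Fin m) ℂ} {M : Matrix (Fin n) (Fin n) ℂ}
    (hB : B.IsHermitian) (hP : P.IsHermitian) (hM : M.IsHermitian)
    (Φ : EuclideanSpace ℂ (Fin l) × EuclideanSpace ℂ (Fin m) →ₗ[ℂ] EuclideanSpace ℂ (Fin n))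
    (R : EuclideanSpace ℂ (Fin l) → EuclideanSpace ℂ (Fin m))
    (hnorm : ∀ x w, ‖Φ (x, w)‖ ^ 2 = ‖x‖ ^ 2 + ‖w - R x‖ ^ 2)
    (hquad : ∀ x w, quadForm M (Φ (x, w)) = quadForm B x + quadForm P w)
    {r b : ℝ} (hb : 0 ≤ b) (hR : ∀ x, ‖R x‖ ≤ r * ‖x‖)
    (hβ : ∀ i, |hB.eigenvalues i| ≤ b) (hπ : ∀ i, 2 * b ≤ |hP.eigenvalues i|) :
    ∃ σ : Fin l ⊕ Fin m ≃ Fin n, ∀ j : Fin l,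
      |hM.eigenvalues (σ (Sum.inl j)) - hB.eigenvalues (sortIndex l j)| ≤ 2 * b * r ^ 2 := by
  have hΦ : Function.Injective Φ := by
    refine (injective_iff_map_eq_zero Φ).2 fun ⟨x, w⟩ h => ?_
    have h0 := hnorm x w
    rw [h, norm_zero] at h0
    have hx : x = 0 := by
      rw [← norm_eq_zero]; nlinarith [sq_nonneg ‖w - R x‖, sq_nonneg ‖x‖]
    have hw : w = R x := by
      rw [← sub_eq_zero, ← norm_eq_zero]; nlinarith [sq_nonneg ‖w - R x‖, sq_nonneg ‖x‖]
    have hR0 : R x = 0 := by simpa [hx] using hR x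
    rw [hw, hR0, hx, Prod.mk_zero_zero]
  -- `β_j` is matched with position `S.card + j` in the spectrum of `M`: the positive eigenvalues of
  -- `P` account for the positions before it.
  set S : Finset (Fin m) := Finset.univ.filter fun i => 0 < hP.eigenvalues i with hS
  have hcard : S.card + Sᶜ.card = m := by simp [S.card_add_card_compl]
  have hidx : ∀ j : Fin l, S.card + j < n := fun j => by omega
  obtain ⟨σ, hσ⟩ := exists_equiv_sum_extending hl
    (fun j => sortIndex n ⟨S.card + j, hidx j⟩) (fun i j hij => by
      have := (sortIndex n).injective hij
      simp only [Fin.mk.injEq] at this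
      omega)
  obtain ⟨Wp, hWp, hqp⟩ := hP.exists_submodule_quadForm S
  obtain ⟨Wn, hWn, hqn⟩ := hP.exists_submodule_quadForm Sᶜ
  have hshear : ∀ x w, ‖w - R x‖ ^ 2 ≤ 2 * ‖w‖ ^ 2 + 2 * r ^ 2 * ‖x‖ ^ 2 := by
    intro x w
    have h := sq_norm_sub_le w (R x)
    have h' := pow_le_pow_left₀ (norm_nonneg _) (hR x) 2
    rw [mul_pow] at h'
    linarith
  have hbr : 0 ≤ 2 * b * r ^ 2 := by positivity
  refine ⟨σ, fun j => ?_⟩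
  set β := hB.eigenvalues (sortIndex l j) with hβdef
  have hβj := abs_le.1 (hβ (sortIndex l j))
  rw [hσ, abs_le]
  constructor
  · obtain ⟨X, hX, hqX⟩ := hB.exists_submodule_quadForm
      ((Finset.Iic j).map (sortIndex l).toEmbedding)
    have := hM.le_eigenvalues_of_finrank ⟨S.card + j, hidx j⟩ (t := β - 2 * b * r ^ 2)
      ((X.prod Wp).map Φ) (by
        rw [← (Submodule.equivMapOfInjective Φ hΦ _).finrank_eq, Submodule.finrank_prod_eq_add, hX, hWp,
          Finset.card_map, Fin.card_Iic]
        simp only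
        omega) (by
        rintro _ ⟨⟨x, w⟩, ⟨hx, hw⟩, rfl⟩
        have h1 := (hqX x hx β).1 (by
          intro i hi
          obtain ⟨a, ha, rfl⟩ := Finset.mem_map.1 hi
          exact hB.eigenvalues_sortIndex_antitone (Finset.mem_Iic.1 ha))
        have h2 := (hqp w hw (2 * b)).1 (by
          intro i hi
          rw [← abs_of_pos (Finset.mem_filter.1 hi).2]
          exact hπ i)
        -- Since `β ≤ b`, the term `β‖w - R x‖²` costs at most `2b‖w‖² + 2br²‖x‖²`. The form of `P`
        -- pays the first part, which is why the gap is `2b`; the second is the stated error.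
        have h3 := mul_le_mul_of_nonneg_left (hshear x w) hb
        have h4 := mul_le_mul_of_nonneg_right hβj.2 (sq_nonneg ‖w - R x‖)
        have h5 := mul_nonneg hbr (sq_nonneg ‖w - R x‖)
        rw [hnorm, hquad]
        linarith)
    linarith
  · obtain ⟨X, hX, hqX⟩ := hB.exists_submodule_quadForm
      ((Finset.Ici j).map (sortIndex l).toEmbedding)
    have := hM.eigenvalues_le_of_finrank ⟨S.card + j, hidx j⟩ (t := β + 2 * b * r ^ 2)
      ((X.prod Wn).map Φ) (by
        rw [← (Submodule.equivMapOfInjective Φ hΦ _).finrank_eq, Submodule.finrank_prod_eq_add, hX, hWn,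
          Finset.card_map, Fin.card_Ici]
        simp only
        omega) (by
        rintro _ ⟨⟨x, w⟩, ⟨hx, hw⟩, rfl⟩
        have h1 := (hqX x hx β).2 (by
          intro i hi
          obtain ⟨a, ha, rfl⟩ := Finset.mem_map.1 hi
          exact hB.eigenvalues_sortIndex_antitone (Finset.mem_Ici.1 ha))
        have h2 := (hqn w hw (-(2 * b))).2 (by
          intro i hi
          -- A zero eigenvalue of `P` can occur here only when `b = 0`, and the bound still holds.
          have hi' : hP.eigenvalues i ≤ 0 := by simpa [hS] using hi
          have := hπ i
          rw [abs_of_nonpos hi'] at this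
          linarith)
        have h3 := mul_le_mul_of_nonneg_left (hshear x w) hb
        have h4 := mul_le_mul_of_nonneg_right hβj.1 (sq_nonneg ‖w - R x‖)
        have h5 := mul_nonneg hbr (sq_nonneg ‖w - R x‖)
        rw [hnorm, hquad]
        linarith)
    linarith

end Matrix.IsHermitian

/-! ### Operator norms and lower bounds -/

namespace Matrix

section Euclidean

variable {ι κ μ : Type*} [Fintype ι] [Fintype κ] [DecidableEq κ] [Fintype μ] [DecidableEq μ]

theorem norm_toEuclideanLin_le (A : Matrix ι κ ℂ) (x : EuclideanSpace ℂ κ) :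
    ‖toEuclideanLin A x‖ ≤ ‖A‖ * ‖x‖ :=
  A.l2_opNorm_mulVec x

theorem l2_opNorm_le_of_forall (A : Matrix ι κ ℂ) {c : ℝ} (hc : 0 ≤ c)
    (h : ∀ x, ‖toEuclideanLin A x‖ ≤ c * ‖x‖) : ‖A‖ ≤ c := by
  rw [l2_opNorm_def]
  exact ContinuousLinearMap.opNorm_le_bound _ hc h

theorem toEuclideanLin_mul_apply (A : Matrix ι κ ℂ) (B : Matrix κ μ ℂ) (x : EuclideanSpace ℂ μ) :
    toEuclideanLin (A * B) x = toEuclideanLin A (toEuclideanLin B x) := by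
  simp [toLpLin_apply, mulVec_mulVec]

theorem toEuclideanLin_one_apply [DecidableEq ι] (x : EuclideanSpace ℂ ι) :
    toEuclideanLin (1 : Matrix ι ι ℂ) x = x := by
  simp

theorem inner_toEuclideanLin_left [DecidableEq ι] (A : Matrix ι κ ℂ) (x : EuclideanSpace ℂ κ)
    (y : EuclideanSpace ℂ ι) :
    inner ℂ (toEuclideanLin A x) y = inner ℂ x (toEuclideanLin Aᴴ y) := by
  rw [toEuclideanLin_conjTranspose_eq_adjoint, LinearMap.adjoint_inner_right]

theorem quadForm_one [DecidableEq ι] (x : EuclideanSpace ℂ ι) : quadForm 1 x = ‖x‖ ^ 2 := by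
  rw [quadForm, toEuclideanLin_one_apply]
  exact inner_self_eq_norm_sq (𝕜 := ℂ) x

/-- The quadratic form of `H` splits along a sum of two `H`-orthogonal ranges. -/
theorem IsHermitian.quadForm_add [DecidableEq ι] {H : Matrix ι ι ℂ} (hH : H.IsHermitian)
    {S : Matrix ι κ ℂ} {T : Matrix ι μ ℂ} (h : Sᴴ * H * T = 0) (x : EuclideanSpace ℂ κ) (y : EuclideanSpace ℂ μ) :
    quadForm H (toEuclideanLin S x + toEuclideanLin T y) =
      quadForm (Sᴴ * H * S) x + quadForm (Tᴴ * H * T) y := by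
  have h' : Tᴴ * H * S = 0 := by
    have := congrArg Matrix.conjTranspose h
    simpa [conjTranspose_mul, hH.eq, Matrix.mul_assoc] using this
  simp only [quadForm, map_add, inner_add_left, inner_add_right, inner_toEuclideanLin_left,
    ← toEuclideanLin_mul_apply, h, h', ← Matrix.mul_assoc, map_zero, LinearMap.zero_apply,
    inner_zero_right, Complex.add_re, Complex.zero_re]
  ring

theorem norm_sq_toEuclideanLin_add [DecidableEq ι] {S : Matrix ι κ ℂ} {T : Matrix ι μ ℂ}
    (hS : Sᴴ * S = 1)
    (hT : Tᴴ * T = 1) (hST : Sᴴ * T = 0) (x : EuclideanSpace ℂ κ) (y : EuclideanSpace ℂ μ) :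
    ‖toEuclideanLin S x + toEuclideanLin T y‖ ^ 2 = ‖x‖ ^ 2 + ‖y‖ ^ 2 := by
  have h := isHermitian_one.quadForm_add (H := (1 : Matrix ι ι ℂ)) (S := S) (T := T)
    (by rw [Matrix.mul_one, hST]) x y
  simpa only [Matrix.mul_one, hS, hT, quadForm_one] using h

theorem l2_opNorm_le_one_of_conjTranspose_mul_self [DecidableEq ι] {S : Matrix ι κ ℂ}
    (hS : Sᴴ * S = 1) :
    ‖S‖ ≤ 1 := by
  refine l2_opNorm_le_of_forall S zero_le_one fun x => ?_
  -- An empty second block reduces the Pythagorean identity to `S` alone.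
  have := norm_sq_toEuclideanLin_add (μ := Fin 0) (T := 0) hS (Subsingleton.elim _ _)
    (Subsingleton.elim _ _) x 0
  rw [map_zero, add_zero, norm_zero, zero_pow two_ne_zero, add_zero] at this
  rw [one_mul]
  exact ((sq_eq_sq₀ (norm_nonneg _) (norm_nonneg _)).1 this).le

theorem l2_opNorm_conjTranspose_mul_mul_le [DecidableEq ι] {S : Matrix ι κ ℂ} {T : Matrix ι μ ℂ}
    (hS : ‖S‖ ≤ 1)
    (hT : ‖T‖ ≤ 1) (E : Matrix ι ι ℂ) : ‖Sᴴ * E * T‖ ≤ ‖E‖ := by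
  have hS' : ‖Sᴴ‖ ≤ 1 := (l2_opNorm_conjTranspose S).trans_le hS
  have h1 := l2_opNorm_mul (Sᴴ * E) T
  have h2 := l2_opNorm_mul Sᴴ E
  have h3 : ‖Sᴴ‖ * ‖E‖ ≤ 1 * ‖E‖ := mul_le_mul_of_nonneg_right hS' (norm_nonneg _)
  have h4 : ‖Sᴴ * E‖ * ‖T‖ ≤ ‖Sᴴ * E‖ * 1 := mul_le_mul_of_nonneg_left hT (norm_nonneg _)
  linarith

theorem IsHermitian.norm_toEuclideanLin_eigenvectorBasis [DecidableEq ι] {H : Matrix ι ι ℂ}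
    (hH : H.IsHermitian)
    (i : ι) : ‖toEuclideanLin H (hH.eigenvectorBasis i)‖ = |hH.eigenvalues i| := by
  rw [hH.toEuclideanLin_eigenvectorBasis, norm_smul, hH.eigenvectorBasis.orthonormal.1 i,
    mul_one, Complex.norm_real, Real.norm_eq_abs]

theorem IsHermitian.abs_eigenvalues_le [DecidableEq ι] {H : Matrix ι ι ℂ} (hH : H.IsHermitian)
    (i : ι) :
    |hH.eigenvalues i| ≤ ‖H‖ := by
  rw [← hH.norm_toEuclideanLin_eigenvectorBasis]
  simpa [hH.eigenvectorBasis.orthonormal.1 i] using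
    norm_toEuclideanLin_le H (hH.eigenvectorBasis i)

theorem IsHermitian.le_abs_eigenvalues [DecidableEq ι] {H : Matrix ι ι ℂ}
    (hH : H.IsHermitian) {c : ℝ}
    (h : ∀ x, c * ‖x‖ ≤ ‖toEuclideanLin H x‖) (i : ι) : c ≤ |hH.eigenvalues i| := by
  rw [← hH.norm_toEuclideanLin_eigenvectorBasis]
  simpa [hH.eigenvectorBasis.orthonormal.1 i] using h (hH.eigenvectorBasis i)

theorem isUnit_of_le_norm_toEuclideanLin [DecidableEq ι] {P : Matrix ι ι ℂ} {c : ℝ} (hc : 0 < c)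
    (h : ∀ x, c * ‖x‖ ≤ ‖toEuclideanLin P x‖) : IsUnit P := by
  rw [← mulVec_injective_iff_isUnit]
  refine (injective_iff_map_eq_zero P.mulVecLin).2 fun v hv => ?_
  have h0 := h (WithLp.toLp 2 v)
  have hz : toEuclideanLin P (WithLp.toLp 2 v) = 0 := by
    rw [mulVecLin_apply] at hv
    simp [toLpLin_apply, hv]
  rw [hz, norm_zero] at h0
  have : ‖(WithLp.toLp 2 v : EuclideanSpace ℂ ι)‖ = 0 := by
    nlinarith [norm_nonneg (WithLp.toLp 2 v : EuclideanSpace ℂ ι)]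
  simpa using this

theorem l2_opNorm_inv_le [DecidableEq ι] {P : Matrix ι ι ℂ} {c : ℝ} (hc : 0 < c)
    (h : ∀ x, c * ‖x‖ ≤ ‖toEuclideanLin P x‖) : ‖P⁻¹‖ ≤ c⁻¹ := by
  refine l2_opNorm_le_of_forall _ (inv_nonneg.2 hc.le) fun x => ?_
  have hP := (isUnit_iff_isUnit_det P).1 (isUnit_of_le_norm_toEuclideanLin hc h)
  have := h (toEuclideanLin P⁻¹ x)
  rw [← toEuclideanLin_mul_apply, mul_nonsing_inv P hP, toEuclideanLin_one_apply] at this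
  rwa [inv_mul_eq_div, le_div_iff₀' hc]

theorem le_norm_toEuclideanLin_diagonal [DecidableEq ι] {τ : ι → ℝ} {c : ℝ} (hc : 0 ≤ c)
    (h : ∀ i, c ≤ |τ i|)
    (x : EuclideanSpace ℂ ι) :
    c * ‖x‖ ≤ ‖toEuclideanLin (diagonal fun i => (τ i : ℂ)) x‖ := by
  refine le_of_sq_le_sq ?_ (norm_nonneg _)
  rw [mul_pow, EuclideanSpace.norm_sq_eq, EuclideanSpace.norm_sq_eq, Finset.mul_sum]
  refine Finset.sum_le_sum fun i _ => ?_
  have : toEuclideanLin (diagonal fun i => (τ i : ℂ)) x i = τ i * x i := by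
    simp [toLpLin_apply, mulVec_diagonal]
  rw [this, norm_mul, mul_pow, Complex.norm_real, Real.norm_eq_abs]
  exact mul_le_mul_of_nonneg_right (pow_le_pow_left₀ hc (h i) 2) (sq_nonneg _)

/-- On a complement of its kernel a linear map is injective, hence antilipschitz in finite
dimension. Applied to `A₀`, this yields the one constant on which both radii and `c` depend. -/
theorem exists_submodule_le_norm_toEuclideanLin (A : Matrix ι κ ℂ) :
    ∃ g : ℝ, 0 < g ∧ ∃ W : Submodule ℂ (EuclideanSpace ℂ κ), Module.finrank ℂ W = A.rank ∧
      ∀ v ∈ W, g * ‖v‖ ≤ ‖toEuclideanLin A v‖ := by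
  obtain ⟨W, hW⟩ := (LinearMap.ker (toEuclideanLin A)).exists_isCompl
  have hinj : LinearMap.ker ((toEuclideanLin A).domRestrict W) = ⊥ := by
    rw [LinearMap.ker_domRestrict, ← Submodule.disjoint_iff_comap_eq_bot]
    exact hW.disjoint.symm
  obtain ⟨K, hK, hanti⟩ := LinearMap.exists_antilipschitzWith _ hinj
  refine ⟨(K : ℝ)⁻¹, by positivity, W, ?_, fun v hv => ?_⟩
  · have h1 := Submodule.finrank_add_eq_of_isCompl hW
    have h2 := (toEuclideanLin A).finrank_range_add_finrank_ker
    have h3 : A.rank = Module.finrank ℂ (LinearMap.range (toEuclideanLin A)) := by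
      rw [toEuclideanLin_eq_toLin_orthonormal]
      exact A.rank_eq_finrank_range_toLin _ _
    omega
  · rw [inv_mul_le_iff₀ (by positivity)]
    have := hanti.le_mul_dist ⟨v, hv⟩ 0
    simpa [dist_eq_norm] using this

end Euclidean

end Matrix

/-! ### Blocks, spectral gap and elimination for a kernel splitting -/

open Matrix

namespace IsKernelSplitting

variable {n l m : ℕ} {A : Matrix (Fin n) (Fin n) ℂ} {U : Matrix (Fin n) (Fin l ⊕ Fin m) ℂ}
  {τ : Fin m → ℝ}

theorem conjTranspose_toCols_mul (h : IsKernelSplitting A U τ) :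
    U.toCols₁ᴴ * U.toCols₁ = 1 ∧ U.toCols₂ᴴ * U.toCols₂ = 1 ∧ U.toCols₁ᴴ * U.toCols₂ = 0 := by
  have h1 := h.conjTranspose_mul_self
  rw [← fromCols_toCols U, conjTranspose_fromCols_eq_fromRows_conjTranspose,
    fromRows_mul_fromCols, ← fromBlocks_one, fromBlocks_inj] at h1
  exact ⟨h1.1, h1.2.2.2, h1.2.1⟩

theorem mul_toCols (h : IsKernelSplitting A U τ) :
    A * U.toCols₁ = 0 ∧ A * U.toCols₂ = U.toCols₂ * diagonal fun i => (τ i : ℂ) := by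
  have h1 : A * U = U * kernelModel l τ := by
    rw [h.spectral, Matrix.mul_assoc, h.conjTranspose_mul_self, Matrix.mul_one]
  rw [← fromCols_toCols U, mul_fromCols, kernelModel, fromCols_mul_fromBlocks] at h1
  simpa using fromCols_inj h1

theorem toBlocks_hat (U : Matrix (Fin n) (Fin l ⊕ Fin m) ℂ) (E : Matrix (Fin n) (Fin n) ℂ) :
    (KernelSplitting.hat U E).toBlocks₁₁ = U.toCols₁ᴴ * E * U.toCols₁ ∧
    KernelSplitting.blockC U E = U.toCols₁ᴴ * E * U.toCols₂ ∧
    KernelSplitting.blockD U E = U.toCols₂ᴴ * E * U.toCols₂ := by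
  have h : KernelSplitting.hat U E = fromBlocks (U.toCols₁ᴴ * E * U.toCols₁)
      (U.toCols₁ᴴ * E * U.toCols₂) (U.toCols₂ᴴ * E * U.toCols₁) (U.toCols₂ᴴ * E * U.toCols₂) := by
    rw [KernelSplitting.hat]
    nth_rewrite 1 2 [← fromCols_toCols U]
    rw [conjTranspose_fromCols_eq_fromRows_conjTranspose, fromRows_mul, fromRows_mul_fromCols]
  simp [KernelSplitting.blockC, KernelSplitting.blockD, h]

/-- A matrix bounded below by `g` on a subspace of dimension `m` has no nonzero eigenvalue of
modulus less than `g` if its kernel has codimension `m`. -/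
theorem le_abs (h : IsKernelSplitting A U τ) (hl : l + m = n) {g : ℝ}
    (W : Submodule ℂ (EuclideanSpace ℂ (Fin n))) (hW : Module.finrank ℂ W = m)
    (hg : ∀ v ∈ W, g * ‖v‖ ≤ ‖toEuclideanLin A v‖) (i : Fin m) : g ≤ |τ i| := by
  obtain ⟨h11, h22, h12⟩ := h.conjTranspose_toCols_mul
  obtain ⟨hA1, hA2⟩ := h.mul_toCols
  set Φ := (toEuclideanLin U.toCols₁).coprod (toEuclideanLin U.toCols₂) with hΦ
  have hnorm : ∀ x y, ‖Φ (x, y)‖ ^ 2 = ‖x‖ ^ 2 + ‖y‖ ^ 2 :=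
    fun x y => norm_sq_toEuclideanLin_add h11 h22 h12 x y
  have hinj : Function.Injective Φ := by
    refine (injective_iff_map_eq_zero Φ).2 fun ⟨x, y⟩ h0 => ?_
    have := hnorm x y
    rw [h0, norm_zero, zero_pow two_ne_zero, eq_comm,
      add_eq_zero_iff_of_nonneg (sq_nonneg _) (sq_nonneg _)] at this
    simpa using this
  set e : EuclideanSpace ℂ (Fin m) := EuclideanSpace.single i 1
  have he : e ≠ 0 := by simp [e]
  -- `ker A` together with the eigenvector of `τ i` has dimension `l + 1`, so it meets `W`; on it
  -- `A` stretches by at most `|τ i|`.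
  obtain ⟨v, hv, ⟨⟨x, y⟩, ⟨-, hy⟩, rfl⟩, hv0⟩ :=
    Submodule.exists_ne_zero_mem_of_finrank_lt (P := W)
      (Q := ((⊤ : Submodule ℂ (EuclideanSpace ℂ (Fin l))).prod (ℂ ∙ e)).map Φ) (by
        rw [← (Submodule.equivMapOfInjective Φ hinj _).finrank_eq, Submodule.finrank_prod_eq_add,
          finrank_span_singleton he, finrank_top, finrank_euclideanSpace, finrank_euclideanSpace,
          Fintype.card_fin, Fintype.card_fin, hW]
        omega)
  obtain ⟨c, rfl⟩ := Submodule.mem_span_singleton.1 hy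
  have hAΦ : toEuclideanLin A (Φ (x, c • e)) =
      toEuclideanLin U.toCols₁ 0 + toEuclideanLin U.toCols₂ ((τ i : ℂ) • c • e) := by
    have hd : toEuclideanLin (diagonal fun i => (τ i : ℂ)) e = (τ i : ℂ) • e := by
      ext j
      by_cases hj : j = i
      · subst hj; simp [e, toLpLin_apply]
      · simp [e, toLpLin_apply, hj]
    rw [hΦ, LinearMap.coprod_apply, map_add, ← toEuclideanLin_mul_apply,
      ← toEuclideanLin_mul_apply, hA1, hA2, toEuclideanLin_mul_apply, map_smul _ c, hd,
      map_zero, map_zero, LinearMap.zero_apply, smul_comm]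
  have hle : ‖toEuclideanLin A (Φ (x, c • e))‖ ≤ |τ i| * ‖Φ (x, c • e)‖ := by
    refine le_of_sq_le_sq ?_ (by positivity)
    rw [hAΦ, norm_sq_toEuclideanLin_add h11 h22 h12, mul_pow, hnorm, norm_smul (τ i : ℂ),
      Complex.norm_real, Real.norm_eq_abs, mul_pow, norm_zero]
    nlinarith [mul_nonneg (sq_nonneg |τ i|) (sq_nonneg ‖x‖)]
  exact le_of_mul_le_mul_right ((hg _ hv).trans hle) (norm_pos_iff.2 hv0)

theorem norm_blocks_le (h : IsKernelSplitting A U τ) (E : Matrix (Fin n) (Fin n) ℂ) :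
    ‖(KernelSplitting.hat U E).toBlocks₁₁‖ ≤ ‖E‖ ∧ ‖KernelSplitting.blockC U E‖ ≤ ‖E‖ ∧
      ‖KernelSplitting.blockD U E‖ ≤ ‖E‖ := by
  obtain ⟨h11, h22, -⟩ := h.conjTranspose_toCols_mul
  obtain ⟨e11, eC, eD⟩ := toBlocks_hat U E
  have hn1 := l2_opNorm_le_one_of_conjTranspose_mul_self h11
  have hn2 := l2_opNorm_le_one_of_conjTranspose_mul_self h22
  rw [e11, eC, eD]
  exact ⟨l2_opNorm_conjTranspose_mul_mul_le hn1 hn1 E,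
    l2_opNorm_conjTranspose_mul_mul_le hn1 hn2 E, l2_opNorm_conjTranspose_mul_mul_le hn2 hn2 E⟩

theorem le_norm_pivot (h : IsKernelSplitting A U τ) {E : Matrix (Fin n) (Fin n) ℂ} {g : ℝ}
    (hg : 0 ≤ g) (hτ : ∀ i, g ≤ |τ i|) (x : EuclideanSpace ℂ (Fin m)) :
    (g - ‖E‖) * ‖x‖ ≤ ‖toEuclideanLin (KernelSplitting.pivot U τ E) x‖ := by
  have h1 := le_norm_toEuclideanLin_diagonal hg hτ x
  have h2 := norm_toEuclideanLin_le (KernelSplitting.blockD U E) x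
  have h3 := mul_le_mul_of_nonneg_right (h.norm_blocks_le E).2.2 (norm_nonneg x)
  rw [KernelSplitting.pivot, map_add, LinearMap.add_apply]
  have h4 := norm_sub_le_norm_add (toEuclideanLin (diagonal fun i => (τ i : ℂ)) x)
    (toEuclideanLin (KernelSplitting.blockD U E) x)
  linarith

theorem pivot_isHermitian (U : Matrix (Fin n) (Fin l ⊕ Fin m) ℂ) (τ : Fin m → ℝ)
    {E : Matrix (Fin n) (Fin n) ℂ} (hE : E.IsHermitian) :
    (KernelSplitting.pivot U τ E).IsHermitian :=
  (isHermitian_diagonal_of_self_adjoint _ (by ext i; simp)).add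
    ((KernelSplitting.hat_isHermitian U hE).submatrix Sum.inr)

/-- The block elimination of `A + E`: shearing by `(Λ_τ + D)⁻¹ C*` block-diagonalizes the
quadratic form. -/
theorem quadForm_add_shear (h : IsKernelSplitting A U τ) (hA : A.IsHermitian)
    {E : Matrix (Fin n) (Fin n) ℂ} (hE : E.IsHermitian)
    (hP : IsUnit (KernelSplitting.pivot U τ E))
    (x : EuclideanSpace ℂ (Fin l)) (w : EuclideanSpace ℂ (Fin m)) :
    quadForm (A + E) (toEuclideanLin U.toCols₁ x + toEuclideanLin U.toCols₂ (w - toEuclideanLin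
      ((KernelSplitting.pivot U τ E)⁻¹ * (KernelSplitting.blockC U E)ᴴ) x)) =
      quadForm (KernelSplitting.schurB U τ E) x + quadForm (KernelSplitting.pivot U τ E) w := by
  obtain ⟨h11, h22, h12⟩ := h.conjTranspose_toCols_mul
  obtain ⟨hA1, hA2⟩ := h.mul_toCols
  obtain ⟨e11, eC, eD⟩ := toBlocks_hat U E
  set P := KernelSplitting.pivot U τ E with hPdef
  set C := KernelSplitting.blockC U E with hC
  have hPh : P.IsHermitian := pivot_isHermitian U τ hE
  have hPdet := (isUnit_iff_isUnit_det P).1 hP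
  set R := P⁻¹ * Cᴴ with hR
  have hRh : Rᴴ = C * P⁻¹ := by
    rw [hR, conjTranspose_mul, conjTranspose_conjTranspose, hPh.inv.eq]
  have hM12 : U.toCols₁ᴴ * (A + E) * U.toCols₂ = C := by
    rw [eC, Matrix.mul_add, Matrix.add_mul, Matrix.mul_assoc _ A, hA2, ← Matrix.mul_assoc, h12,
      Matrix.zero_mul, zero_add]
  have hM22 : U.toCols₂ᴴ * (A + E) * U.toCols₂ = P := by
    rw [hPdef, KernelSplitting.pivot, eD, Matrix.mul_add, Matrix.add_mul, Matrix.mul_assoc _ A,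
      hA2, ← Matrix.mul_assoc, h22, Matrix.one_mul]
  have hM11 : U.toCols₁ᴴ * (A + E) * U.toCols₁ = (KernelSplitting.hat U E).toBlocks₁₁ := by
    rw [e11, Matrix.mul_add, Matrix.add_mul, Matrix.mul_assoc _ A, hA1, Matrix.mul_zero, zero_add]
  have hM21 : U.toCols₂ᴴ * (A + E) * U.toCols₁ = Cᴴ := by
    rw [← hM12]
    rw [conjTranspose_mul, conjTranspose_mul, (hA.add hE).eq, conjTranspose_conjTranspose,
      Matrix.mul_assoc]
  -- Completing the square: `N* (A + E) U₂ = C - R* P = 0`, and what remains on `N` is the Schur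
  -- complement.
  set N := U.toCols₁ - U.toCols₂ * R with hN
  have hNM : Nᴴ * (A + E) * U.toCols₂ = 0 := by
    rw [hN, conjTranspose_sub, conjTranspose_mul, Matrix.sub_mul, Matrix.sub_mul, hM12,
      Matrix.mul_assoc, Matrix.mul_assoc, ← Matrix.mul_assoc U.toCols₂ᴴ, hM22, hRh,
      Matrix.mul_assoc, nonsing_inv_mul P hPdet, Matrix.mul_one, sub_self]
  have hNMN : Nᴴ * (A + E) * N = KernelSplitting.schurB U τ E := by
    have : Nᴴ * (A + E) * N = Nᴴ * (A + E) * U.toCols₁ - Nᴴ * (A + E) * U.toCols₂ * R := by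
      rw [Matrix.mul_assoc _ _ R, ← Matrix.mul_sub]
    rw [this, hNM, Matrix.zero_mul, sub_zero, hN, conjTranspose_sub, conjTranspose_mul,
      Matrix.sub_mul, Matrix.sub_mul, hM11, Matrix.mul_assoc, Matrix.mul_assoc,
      ← Matrix.mul_assoc U.toCols₂ᴴ, hM21, hRh]
    rfl
  have key := (hA.add hE).quadForm_add hNM x w
  rw [hNMN, hM22] at key
  rw [← key]
  congr 1
  rw [hN, map_sub, map_sub, LinearMap.sub_apply, toEuclideanLin_mul_apply U.toCols₂ R]
  abel

end IsKernelSplitting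

/-! ### Choice of constants and conclusion -/

theorem theorem4p1 (n m l : ℕ) (hl : l + m = n)
    (A₀ : Matrix (Fin n) (Fin n) ℂ) (hA₀ : A₀.IsHermitian) (hA₀rank : A₀.rank = m) :
    ∃ rA : ℝ, 0 < rA ∧ ∃ rE : ℝ, 0 < rE ∧ ∃ c : ℝ, 0 < c ∧
      ∀ (A : Matrix (Fin n) (Fin n) ℂ) (hA : A.IsHermitian), A.rank = m → ‖A - A₀‖ < rA →
      ∀ (U : Matrix (Fin n) (Fin l ⊕ Fin m) ℂ) (τ : Fin m → ℝ), IsKernelSplitting A U τ →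
      ∀ (E : Matrix (Fin n) (Fin n) ℂ) (hE : E.IsHermitian), ‖E‖ < rE →
        IsUnit (KernelSplitting.pivot U τ E) ∧
        ∃ σ : Fin l ⊕ Fin m ≃ Fin n, ∀ j : Fin l,
          |(hA.add hE).eigenvalues (σ (Sum.inl j)) - KernelSplitting.beta U τ hE j| ≤
            c * ‖KernelSplitting.schurB U τ E‖ * ‖KernelSplitting.blockC U E‖ ^ 2 := by
  obtain ⟨g, hg, W, hW, hgW⟩ := exists_submodule_le_norm_toEuclideanLin A₀
  -- The radius `g / 2` leaves `|τ_i| ≥ g / 2`. Then `‖E‖ < g / 16` keeps the pivot bounded below by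
  -- `g / 4` and gives `‖B‖ ≤ g / 8`, exactly the factor two needed. The constant `c` is `2br²` with
  -- `r = (4 / g)‖C‖` and `b = ‖B‖` factored out.
  refine ⟨g / 2, by positivity, g / 16, by positivity, 2 * (4 / g) ^ 2, by positivity, ?_⟩
  intro A hA _ hAA₀ U τ h E hE hEr
  have hτ : ∀ i, g / 2 ≤ |τ i| := h.le_abs hl W (hW.trans hA₀rank) fun v hv => by
    have h1 := hgW v hv
    have h2 := norm_toEuclideanLin_le (A - A₀) v
    have h3 := mul_le_mul_of_nonneg_right hAA₀.le (norm_nonneg v)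
    rw [map_sub, LinearMap.sub_apply] at h2
    have h4 := norm_sub_norm_le (toEuclideanLin A₀ v) (toEuclideanLin A v)
    rw [norm_sub_rev] at h4
    linarith
  have hpiv : ∀ x, g / 4 * ‖x‖ ≤ ‖toEuclideanLin (KernelSplitting.pivot U τ E) x‖ := fun x =>
    (mul_le_mul_of_nonneg_right (by linarith) (norm_nonneg x)).trans
      (h.le_norm_pivot (by positivity) hτ x)
  have hunit := isUnit_of_le_norm_toEuclideanLin (by positivity) hpiv
  refine ⟨hunit, ?_⟩
  have hinv : ‖(KernelSplitting.pivot U τ E)⁻¹‖ ≤ 4 / g :=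
    (l2_opNorm_inv_le (by positivity) hpiv).trans_eq (inv_div _ _)
  obtain ⟨n11, nC, -⟩ := h.norm_blocks_le E
  obtain ⟨h11, h22, h12⟩ := h.conjTranspose_toCols_mul
  set P := KernelSplitting.pivot U τ E with hP
  set C := KernelSplitting.blockC U E with hC
  have hR : ‖P⁻¹ * Cᴴ‖ ≤ 4 / g * ‖C‖ := by
    have := l2_opNorm_mul P⁻¹ Cᴴ
    rw [l2_opNorm_conjTranspose] at this
    exact this.trans (mul_le_mul_of_nonneg_right hinv (norm_nonneg _))
  have hB : ‖KernelSplitting.schurB U τ E‖ ≤ g / 8 := by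
    have h1 : ‖C * P⁻¹ * Cᴴ‖ ≤ g / 16 := by
      rw [Matrix.mul_assoc]
      have hCg : ‖C‖ ≤ g / 16 := nC.trans hEr.le
      calc ‖C * (P⁻¹ * Cᴴ)‖ ≤ ‖C‖ * (4 / g * ‖C‖) :=
            (l2_opNorm_mul _ _).trans (mul_le_mul_of_nonneg_left hR (norm_nonneg _))
        _ ≤ g / 16 * (4 / g * (g / 16)) := by gcongr
        _ = g / 64 := by field_simp; norm_num
        _ ≤ g / 16 := by linarith
    have h2 := norm_sub_le (KernelSplitting.hat U E).toBlocks₁₁ (C * P⁻¹ * Cᴴ)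
    rw [KernelSplitting.schurB]
    linarith
  have hBh := KernelSplitting.schurB_isHermitian U τ hE
  have hPh := IsKernelSplitting.pivot_isHermitian U τ hE
  obtain ⟨σ, hσ⟩ := Matrix.IsHermitian.exists_equiv_eigenvalues_sub_le hl hBh hPh (hA.add hE)
    ((toEuclideanLin U.toCols₁ - toEuclideanLin U.toCols₂ ∘ₗ toEuclideanLin (P⁻¹ * Cᴴ)).coprod
      (toEuclideanLin U.toCols₂)) (toEuclideanLin (P⁻¹ * Cᴴ))
    (fun x w => by
      rw [← norm_sq_toEuclideanLin_add h11 h22 h12, LinearMap.coprod_apply, LinearMap.sub_apply,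
        LinearMap.comp_apply, map_sub]
      congr 2
      abel)
    (fun x w => by
      rw [← h.quadForm_add_shear hA hE hunit, LinearMap.coprod_apply, LinearMap.sub_apply,
        LinearMap.comp_apply, map_sub]
      congr 1
      abel)
    (r := 4 / g * ‖C‖) (b := ‖KernelSplitting.schurB U τ E‖) (norm_nonneg _)
    (fun x => (norm_toEuclideanLin_le _ x).trans
      (mul_le_mul_of_nonneg_right hR (norm_nonneg _)))
    hBh.abs_eigenvalues_le
    (fun i => le_trans (by linarith) (hPh.le_abs_eigenvalues hpiv i))
  refine ⟨σ, fun j => ?_⟩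
  have := hσ j
  rw [Matrix.IsHermitian.eigenvalues_sortIndex] at this
  refine this.trans_eq ?_
  ring
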